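/- Let $0<\alpha<1$ and $T>0$. For $\beta>0$ and $z\in\mathbb{R}$ let $$E_{\alpha,\beta}(z)=\sum_{k=0}^{\infty}\frac{z^k}{\Gamma(\alpha k+\beta)}$$ be the two-parameter Mittag-Leffler function. Let $R:[0,T]\to\mathbb{R}$ be a positive continuous function with $R_0:=\inf_{t\in[0,T]}|R(t)|>0$, and set $\|R\|_\infty:=\sup_{t\in[0,T]}|R(t)|$. Then for every integer $p\ge 1$ the function $s\mapsto (T-s)^{\alpha-1}E_{\alpha,\alpha}(-p^2(T-s)^\alpha)R(s)$ is integrable on $(0,T)$ and $$\frac{R_0\,[1-E_{\alpha,1}(-T^\alpha)]}{p^2}\;\le\;\int_0^T (T-s)^{\alpha-1}E_{\alpha,\alpha}\bigl(-p^2(T-s)^\alpha\bigr)R(s)\,ds\;\le\;\frac{\|R\|_\infty}{p^2}.$$ -/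

import Mathlib

/-- The two-parameter Mittag-Leffler function on the real line,
`E_{α,β}(z) = ∑_{k ≥ 0} z ^ k / Γ(α k + β)`.
For `α, β > 0` the series converges for every `z`: see `summable_mittagLeffler`. -/
noncomputable def mittagLeffler (α β z : ℝ) : ℝ :=
  ∑' k : ℕ, z ^ k / Real.Gamma (α * k + β)

/-- A lower bound for the Gamma function that beats every geometric sequence. -/
theorem rpow_mul_exp_neg_le_Gamma {M x : ℝ} (hM : 0 < M) (hx : 1 ≤ x) :
    M ^ (x - 1) * Real.exp (-M) ≤ Real.Gamma x := by
  have hint := Real.GammaIntegral_convergent (s := x) (by linarith)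
  have hsub : Set.Ioi M ⊆ Set.Ioi (0 : ℝ) := Set.Ioi_subset_Ioi hM.le
  rw [Real.Gamma_eq_integral (by linarith), mul_comm, ← integral_exp_neg_Ioi M,
    ← MeasureTheory.integral_mul_const]
  refine le_trans (MeasureTheory.setIntegral_mono_on
    (g := fun t : ℝ => Real.exp (-t) * t ^ (x - 1)) ?_ (hint.mono_set hsub)
    measurableSet_Ioi ?_) ?_
  · exact (integrableOn_exp_neg_Ioi M).mul_const _
  · intro t ht
    have ht' : M < t := ht
    have : M ^ (x - 1) ≤ t ^ (x - 1) :=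
      Real.rpow_le_rpow hM.le ht'.le (by linarith)
    gcongr
  · refine MeasureTheory.setIntegral_mono_set hint ?_ hsub.eventuallyLE
    refine (MeasureTheory.ae_restrict_iff' measurableSet_Ioi).2 (Filter.Eventually.of_forall ?_)
    intro t ht
    have : (0 : ℝ) < t := ht
    simp only [Pi.zero_apply]
    positivity

/-- The series defining the Mittag-Leffler function converges, so `mittagLeffler` is its sum. -/
theorem summable_mittagLeffler {α : ℝ} (hα : 0 < α) (β z : ℝ) :
    Summable fun k : ℕ => z ^ k / Real.Gamma (α * k + β) := by
  set L : ℝ := 2 * (|z| + 1) with hL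
  have hz : 0 ≤ |z| := abs_nonneg z
  have hLpos : 0 < L := by positivity
  set M : ℝ := L ^ (1 / α) with hMdef
  have hM : 0 < M := Real.rpow_pos_of_pos hLpos _
  have hMα : M ^ α = L := by
    rw [hMdef, ← Real.rpow_mul hLpos.le, one_div_mul_cancel hα.ne', Real.rpow_one]
  have hr : |z| / L < 1 := by
    rw [div_lt_one hLpos]; linarith
  have hgeo : Summable fun k : ℕ => (|z| / L) ^ k * (M ^ (1 - β) * Real.exp M) :=
    (summable_geometric_of_lt_one (by positivity) hr).mul_right _
  refine Summable.of_norm_bounded_eventually_nat hgeo ?_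
  obtain ⟨N, hN⟩ := exists_nat_ge ((1 - β) / α)
  filter_upwards [Filter.eventually_ge_atTop N] with k hk
  have hk1 : 1 ≤ α * k + β := by
    have h1 : (1 - β) / α ≤ k := hN.trans (by exact_mod_cast hk)
    rw [div_le_iff₀ hα] at h1
    linarith
  have hG := rpow_mul_exp_neg_le_Gamma hM hk1
  have hpos : 0 < M ^ (α * k + β - 1) * Real.exp (-M) := by positivity
  have hsplit : M ^ (α * k + β - 1) = L ^ k * (M ^ (1 - β))⁻¹ := by
    rw [← hMα, ← Real.rpow_natCast, ← Real.rpow_mul hM.le, ← Real.rpow_neg hM.le,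
      ← Real.rpow_add hM]
    congr 1; ring
  rw [norm_div, norm_pow, Real.norm_eq_abs, Real.norm_of_nonneg (hpos.le.trans hG)]
  calc |z| ^ k / Real.Gamma (α * k + β)
      ≤ |z| ^ k / (M ^ (α * k + β - 1) * Real.exp (-M)) := by gcongr
    _ = (|z| / L) ^ k * (M ^ (1 - β) * Real.exp M) := by
      rw [hsplit, Real.exp_neg, div_pow]
      have h1 : M ^ (1 - β) ≠ 0 := (Real.rpow_pos_of_pos hM _).ne'
      field_simp

/-! With `l = p ^ 2`, the kernel is the derivative in `s` of `E_{α,1}(-l (T - s)^α) / l`, so its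
integral is `(1 - E_{α,1}(-l T^α)) / l`. If the kernel is nonnegative, bounding `R` between `R₀` and
its supremum gives both estimates, using that `E_{α,1}` is nonnegative and monotone on `(-∞, 0]`.

All of this rests on `mittagLeffler_neg_nonneg`: `E_{α,b}(-x) ≥ 0` for `α ≤ b`, `x ≥ 0`. Its proof
is a discretization. Expand `F = (1 - X)^(α - b) / (μ + (1 - X)^α)` as `∑ (-μ)^k (1 - X)^(-(α k +
b))`. Its coefficients are nonnegative by a recursion, since `(1 - X)^α` has nonpositive
coefficients after the first. For `μ = x n^(-α)`, the `n`-th coefficient times `n^(1 - b)` tends to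
`E_{α,b}(-x)`. -/

/-! ### Coefficients of `(1 - X)^(-r)`: identities, bounds, asymptotics -/

open Finset in
theorem ring_multichoose_eq_prod_div (r : ℝ) (n : ℕ) :
    Ring.multichoose r n = (∏ j ∈ range n, (r + j)) / n.factorial := by
  have h := Ring.factorial_nsmul_multichoose_eq_ascPochhammer r n
  have h' : ∏ j ∈ range n, (r + j) = (ascPochhammer ℝ n).eval r := by
    clear h
    induction n with
    | zero => simp
    | succ n ih => rw [prod_range_succ, ih, ascPochhammer_succ_eval]
  rw [Polynomial.ascPochhammer_smeval_eq_eval, nsmul_eq_mul, ← h'] at h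
  rw [← h]
  field_simp

open Finset in
/-- The Chu–Vandermonde identity `(1 - X)^(-r) (1 - X)^(-s) = (1 - X)^(-(r + s))`. -/
theorem sum_antidiagonal_multichoose_mul (r s : ℝ) (n : ℕ) :
    ∑ ij ∈ antidiagonal n, Ring.multichoose r ij.1 * Ring.multichoose s ij.2 =
      Ring.multichoose (r + s) n := by
  have h := Ring.add_choose_eq n (Commute.all (-r) (-s))
  have hc (t : ℝ) (m : ℕ) : Ring.choose (-t) m = (-1) ^ m * Ring.multichoose t m := by
    rw [Ring.choose_neg', Units.smul_def, zsmul_eq_mul]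
    simp
  rw [← neg_add, hc] at h
  have h1 : ((-1 : ℝ) ^ n) * (-1) ^ n = 1 := by rw [← mul_pow]; simp
  calc _ = ∑ ij ∈ antidiagonal n,
        (-1) ^ n * (Ring.choose (-r) ij.1 * Ring.choose (-s) ij.2) := by
        refine sum_congr rfl fun ij hij => ?_
        rw [← mem_antidiagonal.mp hij] at h1 ⊢
        rw [hc, hc]
        rw [pow_add] at h1 ⊢
        linear_combination (-(Ring.multichoose r ij.1 * Ring.multichoose s ij.2)) * h1
    _ = _ := by rw [← mul_sum, ← h, ← mul_assoc, h1, one_mul]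

theorem ring_multichoose_nonneg {r : ℝ} (hr : 0 ≤ r) (n : ℕ) : 0 ≤ Ring.multichoose r n := by
  rw [ring_multichoose_eq_prod_div]
  have : 0 ≤ ∏ j ∈ Finset.range n, (r + j) := Finset.prod_nonneg fun j _ => by positivity
  positivity

/-- The coefficients of `(1 - X)^α`, except for the constant one, are nonpositive. -/
theorem ring_multichoose_neg_succ_nonpos {α : ℝ} (h0 : 0 ≤ α) (h1 : α ≤ 1) (n : ℕ) :
    Ring.multichoose (-α) (n + 1) ≤ 0 := by
  rw [ring_multichoose_eq_prod_div, Finset.prod_range_succ']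
  refine div_nonpos_of_nonpos_of_nonneg ?_ (by positivity)
  refine mul_nonpos_of_nonneg_of_nonpos (Finset.prod_nonneg fun j _ => ?_) (by simpa using h0)
  push_cast
  have : (0 : ℝ) ≤ j := by positivity
  linarith

theorem succ_mul_ring_multichoose_succ (r : ℝ) (n : ℕ) :
    (n + 1) * Ring.multichoose r (n + 1) = r * Ring.multichoose (r + 1) n := by
  rw [ring_multichoose_eq_prod_div, ring_multichoose_eq_prod_div, Finset.prod_range_succ',
    Nat.factorial_succ]
  have : ∏ j ∈ Finset.range n, (r + 1 + (j : ℝ)) =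
      ∏ j ∈ Finset.range n, (r + ((j + 1 : ℕ) : ℝ)) :=
    Finset.prod_congr rfl fun j _ => by push_cast; ring
  rw [this]
  push_cast
  field_simp
  ring

theorem hasSum_ring_multichoose_mul_pow (r : ℝ) {z : ℝ} (h0 : 0 ≤ z) (h1 : z < 1) :
    HasSum (fun n => Ring.multichoose r n * z ^ n) ((1 - z) ^ (-r)) := by
  have h := (Real.one_div_one_sub_rpow_hasFPowerSeriesOnBall_zero r).hasSum (y := z) (by
    simp only [Metric.mem_eball, edist_zero_right]
    rw [← ofReal_norm, Real.norm_of_nonneg h0, ENNReal.ofReal_lt_one]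
    exact h1)
  simp only [zero_add] at h
  rw [Real.rpow_neg (by linarith), ← one_div]
  refine h.congr_fun fun n => ?_
  rw [Ring.multichoose_eq]
  simp [mul_comm]

/-- Cauchy-type estimate: all terms of the series at `z` are nonnegative, and `z ^ j ≥ z ^ n` for `j
≤ n`. -/
theorem sum_range_ring_multichoose_le {r z : ℝ} (hr : 0 ≤ r) (h0 : 0 < z) (h1 : z < 1) (n : ℕ) :
    ∑ j ∈ Finset.range (n + 1), Ring.multichoose r j ≤ (z⁻¹) ^ n * (1 - z) ^ (-r) := by
  have hs := sum_le_hasSum (Finset.range (n + 1))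
    (fun j _ => mul_nonneg (ring_multichoose_nonneg hr j) (pow_nonneg h0.le j))
    (hasSum_ring_multichoose_mul_pow r h0.le h1)
  rw [inv_pow, inv_mul_eq_div, le_div_iff₀ (by positivity), Finset.sum_mul]
  refine le_trans (Finset.sum_le_sum fun j hj => ?_) hs
  refine mul_le_mul_of_nonneg_left ?_ (ring_multichoose_nonneg hr j)
  exact pow_le_pow_of_le_one h0.le h1.le (by simpa [Nat.lt_succ_iff] using hj)

theorem ring_multichoose_le {r z : ℝ} (hr : 0 ≤ r) (h0 : 0 < z) (h1 : z < 1) (n : ℕ) :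
    Ring.multichoose r n ≤ (z⁻¹) ^ n * (1 - z) ^ (-r) :=
  (Finset.single_le_sum (fun j _ => ring_multichoose_nonneg hr j)
    (Finset.self_mem_range_succ n)).trans (sum_range_ring_multichoose_le hr h0 h1 n)

/-- The `n`-th coefficient, times `n`, is `r` times the sum of the preceding ones. The factor `n`
gained over `ring_multichoose_le` makes the dominating series in the limit independent of `n`. -/
theorem nat_mul_ring_multichoose_le {r z : ℝ} (hr : 0 ≤ r) (h0 : 0 < z) (h1 : z < 1) (n : ℕ) :
    n * Ring.multichoose r n ≤ r * ((z⁻¹) ^ n * (1 - z) ^ (-r)) := by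
  have hz : 1 ≤ z⁻¹ := (one_le_inv₀ h0).mpr h1.le
  have hp : 0 ≤ (1 - z) ^ (-r) := Real.rpow_nonneg (by linarith) _
  cases n with
  | zero => simp only [CharP.cast_eq_zero, zero_mul]; positivity
  | succ n =>
    push_cast
    rw [succ_mul_ring_multichoose_succ, ← sum_antidiagonal_multichoose_mul,
      Finset.Nat.sum_antidiagonal_eq_sum_range_succ_mk]
    simp only [Ring.multichoose_one, mul_one]
    refine mul_le_mul_of_nonneg_left ?_ hr
    refine (sum_range_ring_multichoose_le hr h0 h1 n).trans ?_
    gcongr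
    · simp

theorem rpow_mul_ring_multichoose_eq {b : ℝ} (hb : 0 < b) {n : ℕ} (hn : n ≠ 0) :
    (n : ℝ) ^ (1 - b) * Ring.multichoose b n = n / (n + b) * (Real.GammaSeq b n)⁻¹ := by
  have hn' : (0 : ℝ) < n := by positivity
  rw [ring_multichoose_eq_prod_div, Real.GammaSeq, Finset.prod_range_succ, inv_div,
    Real.rpow_sub hn', Real.rpow_one]
  have : (n : ℝ) ^ b ≠ 0 := by positivity
  field_simp
  ring

theorem tendsto_rpow_mul_ring_multichoose {b : ℝ} (hb : 0 < b) :
    Filter.Tendsto (fun n : ℕ => (n : ℝ) ^ (1 - b) * Ring.multichoose b n) Filter.atTop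
      (nhds (Real.Gamma b)⁻¹) := by
  have h := (tendsto_natCast_div_add_atTop b).mul
    ((Real.GammaSeq_tendsto_Gamma b).inv₀ (Real.Gamma_pos_of_pos hb).ne')
  rw [one_mul] at h
  refine h.congr' ?_
  filter_upwards [Filter.eventually_ne_atTop 0] with n hn
  exact (rpow_mul_ring_multichoose_eq hb hn).symm

/-! ### Nonnegativity of the coefficients of `F` -/

theorem norm_neg_pow_mul_ring_multichoose_le {α b μ z : ℝ} (hα : 0 ≤ α) (hb : 0 ≤ b) (hμ : 0 ≤ μ)
    (h0 : 0 < z) (h1 : z < 1) (n k : ℕ) :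
    ‖(-μ) ^ k * Ring.multichoose (α * k + b) n‖ ≤
      (μ * (1 - z) ^ (-α)) ^ k * ((z⁻¹) ^ n * (1 - z) ^ (-b)) := by
  have hz : 0 < 1 - z := by linarith
  have hr : 0 ≤ α * k + b := by positivity
  rw [norm_mul, norm_pow, norm_neg, Real.norm_of_nonneg hμ,
    Real.norm_of_nonneg (ring_multichoose_nonneg hr n)]
  have hle := ring_multichoose_le hr h0 h1 n
  calc _ ≤ μ ^ k * ((z⁻¹) ^ n * (1 - z) ^ (-(α * k + b))) := by gcongr
    _ = _ := by
      rw [neg_add, Real.rpow_add hz, ← neg_mul, Real.rpow_mul hz.le, Real.rpow_natCast, mul_pow]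
      ring

theorem summable_neg_pow_mul_ring_multichoose {α b μ z : ℝ} (hα : 0 ≤ α) (hb : 0 ≤ b)
    (hμ : 0 ≤ μ) (h0 : 0 < z) (h1 : z < 1) (hq : μ * (1 - z) ^ (-α) < 1) (n : ℕ) :
    Summable fun k : ℕ => (-μ) ^ k * Ring.multichoose (α * k + b) n := by
  have hp : 0 ≤ (1 - z) ^ (-α) := Real.rpow_nonneg (by linarith) _
  exact Summable.of_norm_bounded
    ((summable_geometric_of_lt_one (mul_nonneg hμ hp) hq).mul_right _)
    (norm_neg_pow_mul_ring_multichoose_le hα hb hμ h0 h1 n)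

/-- The power series `(1 - X)^(α - b) / (μ + (1 - X)^α)` has nonnegative coefficients. -/
theorem tsum_neg_pow_mul_ring_multichoose_nonneg {α b μ z : ℝ} (hα : 0 < α) (hα1 : α ≤ 1)
    (hb : α ≤ b) (hμ : 0 ≤ μ) (h0 : 0 < z) (h1 : z < 1) (hq : μ * (1 - z) ^ (-α) < 1) (n : ℕ) :
    0 ≤ ∑' k : ℕ, (-μ) ^ k * Ring.multichoose (α * k + b) n := by
  set S : ℕ → ℝ := fun n => ∑' k : ℕ, (-μ) ^ k * Ring.multichoose (α * k + b) n with hS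
  have hsum (j : ℕ) : Summable fun k : ℕ => (-μ) ^ k * Ring.multichoose (α * k + b) j :=
    summable_neg_pow_mul_ring_multichoose hα.le (hα.le.trans hb) hμ h0 h1 hq j
  -- Coefficient form of `(1 - X)^α F = (1 - X)^(α - b) - μ F`.
  have hrec (n : ℕ) : ∑ ij ∈ Finset.HasAntidiagonal.antidiagonal n, Ring.multichoose (-α) ij.1 * S ij.2 =
      Ring.multichoose (b - α) n - μ * S n := by
    calc _ = ∑ ij ∈ Finset.HasAntidiagonal.antidiagonal n, ∑' k : ℕ,
          Ring.multichoose (-α) ij.1 * ((-μ) ^ k * Ring.multichoose (α * k + b) ij.2) := by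
          simp only [hS, tsum_mul_left]
      _ = ∑' k : ℕ, ∑ ij ∈ Finset.HasAntidiagonal.antidiagonal n,
          Ring.multichoose (-α) ij.1 * ((-μ) ^ k * Ring.multichoose (α * k + b) ij.2) :=
          (Summable.tsum_finsetSum fun ij _ => (hsum ij.2).mul_left _).symm
      _ = ∑' k : ℕ, (-μ) ^ k * Ring.multichoose (α * k + (b - α)) n := by
          refine tsum_congr fun k => ?_
          rw [show α * k + (b - α) = -α + (α * k + b) by ring,
            ← sum_antidiagonal_multichoose_mul, Finset.mul_sum]
          exact Finset.sum_congr rfl fun ij _ => by ring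
      _ = _ := by
          rw [(summable_neg_pow_mul_ring_multichoose hα.le (sub_nonneg.mpr hb) hμ h0 h1 hq
            n).tsum_eq_zero_add, sub_eq_add_neg (Ring.multichoose _ _),
            hS, ← tsum_mul_left, ← tsum_neg]
          congr 1
          · simp
          · refine tsum_congr fun k => ?_
            rw [show α * ((k + 1 : ℕ) : ℝ) + (b - α) = α * k + b by push_cast; ring]
            ring
  change 0 ≤ S n
  induction n using Nat.strong_induction_on with
  | _ n ih =>
    have h := hrec n
    rw [Finset.Nat.sum_antidiagonal_eq_sum_range_succ
      (fun i j => Ring.multichoose (-α) i * S j), Finset.sum_range_succ'] at h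
    simp only [Ring.multichoose_zero_right, one_mul, tsub_zero] at h
    have h2 : ∑ i ∈ Finset.range n, Ring.multichoose (-α) (i + 1) * S (n - (i + 1)) ≤ 0 :=
      Finset.sum_nonpos fun i hi => by
        have := Finset.mem_range.mp hi
        exact mul_nonpos_of_nonpos_of_nonneg (ring_multichoose_neg_succ_nonpos hα.le hα1 i)
          (ih _ (by omega))
    have h3 := ring_multichoose_nonneg (sub_nonneg.mpr hb) n
    -- `(1 + μ) * S n` equals the nonnegative `h3` term minus the nonpositive `h2` sum.
    nlinarith

/-! ### Passage to the limit -/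

/-- The coefficients of `(1 - X)^(α - b) / (x n^(-α) + (1 - X)^α)` approximate the Mittag-Leffler
function. -/
theorem tendsto_tsum_ring_multichoose_mittagLeffler {α b x M : ℝ} (hα : 0 < α) (hb : 0 < b)
    (hx : 0 ≤ x) (hM : 0 < M) (hxM : x * M ^ (-α) < 1) :
    Filter.Tendsto (fun n : ℕ => ∑' k : ℕ, (-x) ^ k *
      ((n : ℝ) ^ (1 - (α * k + b)) * Ring.multichoose (α * k + b) n)) Filter.atTop
      (nhds (mittagLeffler α b (-x))) := by
  set q := x * M ^ (-α) with hq
  have hq0 : 0 ≤ q := by positivity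
  have hqn : ‖q‖ < 1 := by rwa [Real.norm_of_nonneg hq0]
  -- Dominating series from `nat_mul_ring_multichoose_le` at `z = 1 - M / n`; `Real.exp M + 1`
  -- eventually bounds `z⁻¹ ^ n`.
  have hbound : Summable fun k : ℕ => (α * k + b) * q ^ k * (M ^ (-b) * (Real.exp M + 1)) := by
    have h1 := (summable_pow_mul_geometric_of_norm_lt_one 1 hqn).mul_left α
    have h2 := (summable_geometric_of_lt_one hq0 hxM).mul_left b
    refine ((h1.add h2).congr fun k => ?_).mul_right _
    ring
  refine tendsto_tsum_of_dominated_convergence hbound (fun k => ?_) ?_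
  · rw [div_eq_mul_inv]
    exact (tendsto_rpow_mul_ring_multichoose (by positivity)).const_mul _
  have hexp : Filter.Tendsto (fun n : ℕ => ((1 - M / n)⁻¹) ^ n) Filter.atTop
      (nhds (Real.exp M)) := by
    have h := (Real.tendsto_one_add_div_pow_exp (-M)).inv₀ (Real.exp_pos _).ne'
    rw [← Real.exp_neg, neg_neg] at h
    refine h.congr fun n => ?_
    rw [inv_pow, neg_div, sub_eq_add_neg]
  filter_upwards [hexp.eventually_le_const (lt_add_one _),
    tendsto_natCast_atTop_atTop.eventually_gt_atTop M] with n hn hnM k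
  have hn0 : (0 : ℝ) < n := hM.trans hnM
  have hr : 0 < α * k + b := by positivity
  have hz0 : 0 < 1 - M / n := by rw [sub_pos, div_lt_one hn0]; exact hnM
  have hz1 : 1 - M / n < 1 := by have : 0 < M / n := by positivity
                                 linarith
  have hc := nat_mul_ring_multichoose_le hr.le hz0 hz1 n
  rw [sub_sub_cancel] at hc
  have hc0 := ring_multichoose_nonneg hr.le n
  rw [norm_mul, norm_pow, norm_neg, Real.norm_of_nonneg hx, Real.norm_of_nonneg (by positivity)]
  calc x ^ k * ((n : ℝ) ^ (1 - (α * k + b)) * Ring.multichoose (α * k + b) n)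
      = x ^ k * ((n : ℝ) ^ (-(α * k + b)) * (n * Ring.multichoose (α * k + b) n)) := by
        rw [sub_eq_add_neg, Real.rpow_add hn0, Real.rpow_one]; ring
    _ ≤ x ^ k * ((n : ℝ) ^ (-(α * k + b)) *
          ((α * k + b) * ((Real.exp M + 1) * (M / n) ^ (-(α * k + b))))) := by
        have hc' : n * Ring.multichoose (α * k + b) n ≤
            (α * k + b) * ((Real.exp M + 1) * (M / n) ^ (-(α * k + b))) := by
          refine hc.trans ?_
          gcongr
        exact mul_le_mul_of_nonneg_left (mul_le_mul_of_nonneg_left hc' (by positivity))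
          (by positivity)
    _ = _ := by
        rw [Real.div_rpow hM.le hn0.le, neg_add, Real.rpow_add hM, ← neg_mul,
          Real.rpow_mul hM.le, Real.rpow_natCast, hq, mul_pow]
        have : (n : ℝ) ^ (-α * k + -b) ≠ 0 := by positivity
        field_simp

theorem mittagLeffler_neg_nonneg {α b x : ℝ} (hα : 0 < α) (hα1 : α ≤ 1) (hb : α ≤ b)
    (hx : 0 ≤ x) : 0 ≤ mittagLeffler α b (-x) := by
  have hb0 := hα.trans_le hb
  -- Chosen so that `x * M ^ (-α) = x / (x + 1) < 1`.
  set M : ℝ := (x + 1) ^ α⁻¹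
  have hM : 0 < M := by positivity
  have hxM : x * M ^ (-α) < 1 := by
    rw [Real.rpow_neg hM.le, Real.rpow_inv_rpow (by positivity) hα.ne', ← div_eq_mul_inv,
      div_lt_one (by positivity)]
    linarith
  refine ge_of_tendsto (tendsto_tsum_ring_multichoose_mittagLeffler hα hb0 hx hM hxM) ?_
  filter_upwards [tendsto_natCast_atTop_atTop.eventually_gt_atTop M] with n hnM
  have hn0 : (0 : ℝ) < n := hM.trans hnM
  have hz0 : 0 < 1 - M / n := by rw [sub_pos, div_lt_one hn0]; exact hnM
  have hz1 : 1 - M / n < 1 := by have : 0 < M / n := by positivity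
                                 linarith
  have h := tsum_neg_pow_mul_ring_multichoose_nonneg (μ := x * (n : ℝ) ^ (-α)) hα hα1 hb
    (by positivity) hz0 hz1 (by
      have : (n : ℝ) ^ (-α) ≠ 0 := by positivity
      rw [sub_sub_cancel, Real.div_rpow hM.le hn0.le]
      field_simp
      linarith) n
  refine (mul_nonneg (Real.rpow_nonneg hn0.le (1 - b)) h).trans_eq ?_
  rw [← tsum_mul_left]
  refine tsum_congr fun k => ?_
  rw [show 1 - (α * k + b) = (1 - b) + -α * k by ring, Real.rpow_add hn0, Real.rpow_mul hn0.le,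
    Real.rpow_natCast, ← neg_mul, mul_pow]
  ring

/-! ### Derivative and monotonicity of `E_{α,1}` -/

theorem hasDerivAt_mittagLeffler_one {α : ℝ} (hα : 0 < α) (x : ℝ) :
    HasDerivAt (mittagLeffler α 1) (mittagLeffler α α x / α) x := by
  have hG (k : ℕ) : ((k + 1 : ℕ) : ℝ) / Real.Gamma (α * (k + 1 : ℕ) + 1) =
      (Real.Gamma (α * k + α))⁻¹ / α := by
    have h1 : α * ((k + 1 : ℕ) : ℝ) ≠ 0 := by positivity
    have h2 : Real.Gamma (α * k + α) ≠ 0 := (Real.Gamma_pos_of_pos (by positivity)).ne'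
    have h3 : ((k + 1 : ℕ) : ℝ) ≠ 0 := by positivity
    rw [Real.Gamma_add_one h1, show α * ((k + 1 : ℕ) : ℝ) = α * k + α by push_cast; ring]
    rw [show α * k + α = α * ((k + 1 : ℕ) : ℝ) by push_cast; ring] at h2 ⊢
    field_simp
  have hshift (y : ℝ) (k : ℕ) :
      ((k + 1 : ℕ) : ℝ) * y ^ (k + 1 - 1) / Real.Gamma (α * (k + 1 : ℕ) + 1) =
      y ^ k / Real.Gamma (α * k + α) / α := by
    rw [mul_div_right_comm, hG, Nat.add_sub_cancel]
    ring
  have hu (y : ℝ) :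
      Summable fun k : ℕ => (k : ℝ) * y ^ (k - 1) / Real.Gamma (α * k + 1) := by
    rw [← summable_nat_add_iff 1]
    simp only [hshift]
    exact (summable_mittagLeffler hα α y).div_const α
  have hx : x ∈ Metric.ball (0 : ℝ) (|x| + 1) := by simp
  have h := hasDerivAt_tsum_of_isPreconnected (hu (|x| + 1)) Metric.isOpen_ball
    (convex_ball (0 : ℝ) (|x| + 1)).isPreconnected
    (g := fun (k : ℕ) y => y ^ k / Real.Gamma (α * k + 1))
    (g' := fun (k : ℕ) y => (k : ℝ) * y ^ (k - 1) / Real.Gamma (α * k + 1))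
    (fun k y _ => (hasDerivAt_pow k y).div_const _) (fun k y hy => ?_) hx
    (summable_mittagLeffler hα 1 x) hx
  · refine HasDerivAt.congr_deriv h ?_
    rw [(hu x).tsum_eq_zero_add, mittagLeffler, ← tsum_div_const]
    simp only [hshift]
    simp
  · have hg : 0 < Real.Gamma (α * k + 1) := Real.Gamma_pos_of_pos (by positivity)
    have hy' : |y| ≤ |x| + 1 := by simpa using (Metric.mem_ball.mp hy).le
    rw [norm_div, norm_mul, norm_pow, Real.norm_of_nonneg hg.le, Real.norm_natCast,
      Real.norm_eq_abs]
    gcongr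

theorem mittagLeffler_one_zero (α : ℝ) : mittagLeffler α 1 0 = 1 := by
  rw [mittagLeffler, tsum_eq_single 0 fun k hk => by simp [hk]]
  simp

theorem monotoneOn_mittagLeffler_one {α : ℝ} (hα : 0 < α) (hα1 : α ≤ 1) :
    MonotoneOn (mittagLeffler α 1) (Set.Iic 0) := by
  refine monotoneOn_of_hasDerivWithinAt_nonneg (f' := fun x => mittagLeffler α α x / α)
    (convex_Iic 0)
    (fun x _ => (hasDerivAt_mittagLeffler_one hα x).continuousAt.continuousWithinAt)
    (fun x _ => (hasDerivAt_mittagLeffler_one hα x).hasDerivWithinAt) fun x hx => ?_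
  rw [interior_Iic] at hx
  have := mittagLeffler_neg_nonneg hα hα1 le_rfl (neg_nonneg.mpr (le_of_lt hx))
  rw [neg_neg] at this
  positivity

/-! ### The kernel and its integral -/

theorem mittagLeffler_kernel_nonneg {α l t : ℝ} (hα : 0 < α) (hα1 : α ≤ 1) (hl : 0 ≤ l)
    (ht : 0 ≤ t) : 0 ≤ t ^ (α - 1) * mittagLeffler α α (-l * t ^ α) := by
  rw [neg_mul]
  exact mul_nonneg (by positivity) (mittagLeffler_neg_nonneg hα hα1 le_rfl (by positivity))

theorem hasDerivAt_mittagLeffler_one_comp_sub {α l T s : ℝ} (hα : 0 < α) (hs : s < T) :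
    HasDerivAt (fun s => mittagLeffler α 1 (-l * (T - s) ^ α))
      (l * ((T - s) ^ (α - 1) * mittagLeffler α α (-l * (T - s) ^ α))) s := by
  have h1 := (((hasDerivAt_id s).const_sub T).rpow_const (p := α)
    (Or.inl (sub_pos.mpr hs).ne')).const_mul (-l)
  have h2 := (hasDerivAt_mittagLeffler_one hα (-l * (T - s) ^ α)).comp s h1
  refine h2.congr_deriv ?_
  simp only [id]
  field_simp

theorem continuous_mittagLeffler_one_comp_sub {α : ℝ} (l T : ℝ) (hα : 0 < α) :
    Continuous fun s => mittagLeffler α 1 (-l * (T - s) ^ α) := by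
  have h : Continuous (mittagLeffler α 1) :=
    continuous_iff_continuousAt.mpr fun x => (hasDerivAt_mittagLeffler_one hα x).continuousAt
  exact h.comp (continuous_const.mul
    ((continuous_const.sub continuous_id).rpow_const fun _ => Or.inr hα.le))

/-- Despite the singularity at `s = T` when `α < 1`, a nonnegative derivative of a function
continuous up to the endpoints is integrable. -/
theorem intervalIntegrable_mittagLeffler_kernel {α l T : ℝ} (hα : 0 < α) (hα1 : α ≤ 1)
    (hl : 0 < l) (hT : 0 ≤ T) :
    IntervalIntegrable (fun s => (T - s) ^ (α - 1) * mittagLeffler α α (-l * (T - s) ^ α))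
      MeasureTheory.volume 0 T := by
  have h := intervalIntegral.intervalIntegrable_deriv_of_nonneg (a := 0) (b := T)
    (continuous_mittagLeffler_one_comp_sub l T hα).continuousOn
    (fun s hs => hasDerivAt_mittagLeffler_one_comp_sub hα (by simpa [hT] using hs.2))
    (fun s hs => mul_nonneg hl.le (mittagLeffler_kernel_nonneg hα hα1 hl.le
      (sub_nonneg.mpr (by simpa [hT] using hs.2.le))))
  refine (h.const_mul l⁻¹).congr fun s _ => ?_
  simp only [← mul_assoc, inv_mul_cancel₀ hl.ne', one_mul]

theorem integral_mittagLeffler_kernel {α l T : ℝ} (hα : 0 < α) (hα1 : α ≤ 1)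
    (hl : 0 < l) (hT : 0 ≤ T) :
    ∫ s in (0 : ℝ)..T, (T - s) ^ (α - 1) * mittagLeffler α α (-l * (T - s) ^ α) =
      (1 - mittagLeffler α 1 (-l * T ^ α)) / l := by
  have h := intervalIntegral.integral_eq_sub_of_hasDerivAt_of_le hT
    (continuous_mittagLeffler_one_comp_sub l T hα).continuousOn
    (fun s hs => hasDerivAt_mittagLeffler_one_comp_sub hα hs.2)
    ((intervalIntegrable_mittagLeffler_kernel hα hα1 hl hT).const_mul l)
  rw [intervalIntegral.integral_const_mul, sub_self, sub_zero, Real.zero_rpow hα.ne', mul_zero,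
    mittagLeffler_one_zero] at h
  rw [eq_div_iff hl.ne', mul_comm, h]

theorem lemma2p2 (α T : ℝ) (hα0 : 0 < α) (hα1 : α < 1) (hT : 0 < T)
    (R : ℝ → ℝ) (hRcont : ContinuousOn R (Set.Icc 0 T))
    (hRpos : ∀ t ∈ Set.Icc 0 T, 0 < R t)
    (R₀ : ℝ) (hR₀ : R₀ = sInf ((fun t => |R t|) '' Set.Icc 0 T)) (hR₀pos : 0 < R₀)
    (p : ℕ) (hp : 1 ≤ p) :
    IntervalIntegrable
        (fun s => (T - s) ^ (α - 1) * mittagLeffler α α (-((p : ℝ) ^ 2) * (T - s) ^ α) * R s)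
        MeasureTheory.volume 0 T ∧
      R₀ * (1 - mittagLeffler α 1 (-(T ^ α))) / (p : ℝ) ^ 2 ≤
        (∫ s in (0 : ℝ)..T,
          (T - s) ^ (α - 1) * mittagLeffler α α (-((p : ℝ) ^ 2) * (T - s) ^ α) * R s) ∧
      (∫ s in (0 : ℝ)..T,
          (T - s) ^ (α - 1) * mittagLeffler α α (-((p : ℝ) ^ 2) * (T - s) ^ α) * R s) ≤
        sSup ((fun t => |R t|) '' Set.Icc 0 T) / (p : ℝ) ^ 2 := by
  have hp1 : (1 : ℝ) ≤ (p : ℝ) ^ 2 := one_le_pow₀ (by exact_mod_cast hp)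
  have hl : (0 : ℝ) < (p : ℝ) ^ 2 := by linarith
  have hTα : 0 ≤ T ^ α := by positivity
  have hK := intervalIntegrable_mittagLeffler_kernel hα0 hα1.le hl hT.le
  have hKint := integral_mittagLeffler_kernel hα0 hα1.le hl hT.le
  have hKnn (s : ℝ) (hs : s ∈ Set.Icc 0 T) := mittagLeffler_kernel_nonneg hα0 hα1.le hl.le
    (sub_nonneg.mpr hs.2)
  have hKR := hK.mul_continuousOn (by rwa [Set.uIcc_of_le hT.le])
  have hcomp : IsCompact ((fun t => |R t|) '' Set.Icc 0 T) := 
    isCompact_Icc.image_of_continuousOn hRcont.abs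
  set N := sSup ((fun t => |R t|) '' Set.Icc 0 T)
  have hlow (s : ℝ) (hs : s ∈ Set.Icc 0 T) : R₀ ≤ R s := by
    rw [hR₀, ← abs_of_pos (hRpos s hs)]
    exact csInf_le hcomp.bddBelow ⟨s, hs, rfl⟩
  have hup (s : ℝ) (hs : s ∈ Set.Icc 0 T) : R s ≤ N := by
    rw [← abs_of_pos (hRpos s hs)]
    exact le_csSup hcomp.bddAbove ⟨s, hs, rfl⟩
  have h0mem : (0 : ℝ) ∈ Set.Icc 0 T := ⟨le_rfl, hT.le⟩
  have hN : 0 ≤ N := (hRpos 0 h0mem).le.trans (hup 0 h0mem)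
  refine ⟨hKR, ?_, ?_⟩
  · have h := intervalIntegral.integral_mono_on hT.le (hK.mul_const R₀) hKR
      fun s hs => mul_le_mul_of_nonneg_left (hlow s hs) (hKnn s hs)
    refine le_trans ?_ h
    rw [intervalIntegral.integral_mul_const, hKint, mul_comm, div_mul_eq_mul_div]
    -- Since `p ^ 2 ≥ 1`, monotonicity removes `p` from the argument.
    have hmono : mittagLeffler α 1 (-(p : ℝ) ^ 2 * T ^ α) ≤ mittagLeffler α 1 (-(T ^ α)) :=
      monotoneOn_mittagLeffler_one hα0 hα1.le (Set.mem_Iic.mpr (by nlinarith))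
        (Set.mem_Iic.mpr (by linarith)) (by nlinarith)
    gcongr
  · have h := intervalIntegral.integral_mono_on hT.le hKR (hK.mul_const N)
      fun s hs => mul_le_mul_of_nonneg_left (hup s hs) (hKnn s hs)
    refine h.trans ?_
    rw [intervalIntegral.integral_mul_const, hKint, div_mul_eq_mul_div]
    have hnn : 0 ≤ mittagLeffler α 1 (-(p : ℝ) ^ 2 * T ^ α) := by
      rw [neg_mul]
      exact mittagLeffler_neg_nonneg hα0 hα1.le hα1.le (by positivity)
    gcongr
    nlinarith
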